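/- Let $\mathcal L$ be a real Lie algebra of anti-Hermitian complex $D\times D$ matrices (a real-linear subspace closed under commutators; for example the Lie algebra generated by all the matrices $iH_A(t)$ and $iH_B(t)$ below, or the dynamical Lie algebra $\mathcal L(\{iH_m\})$ generated by a set of control Hamiltonians $H_m$). Write $e^{\mathcal L}=\{e^{C} : C\in\mathcal L\}$ and $\|A\|_F=\sqrt{\operatorname{tr}A^\dagger A}$, and for $U_1,U_2\in e^{\mathcal L}$ put $$d(U_1,U_2)=\min\{\|C\|_F : C\in\mathcal L,\ e^{C}=U_1U_2^{-1}\}.$$ Let $H_A,H_B$ be functions of $t\ge 0$ with Hermitian $D\times D$ values such that $iH_A(t),iH_B(t)\in\mathcal L$ for all $t\ge 0$, bounded on every bounded interval $[0,T]$, and piecewise continuous (finitely many discontinuities in every bounded interval). Let $U_A,U_B$ be the corresponding propagators: for $X\in\{A,B\}$, $U_X$ is continuous on $[0,\infty)$, $U_X(0)=I$, and $i\,\frac{d}{dt}U_X(t)=H_X(t)U_X(t)$ at every $t>0$ at which $H_X$ is continuous. Then for every $T\ge 0$: $U_A(T),U_B(T)\in e^{\mathcal L}$, the minimum defining $d(U_A(T),U_B(T))$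 is attained, the function $t\mapsto\|H_A(t)-H_B(t)\|_F$ is integrable on $[0,T]$, and $$d(U_A(T),U_B(T))\le\int_0^T\|H_A(t)-H_B(t)\|_F\,dt .$$ This strengthens the Nielsen-type inequality $\|U_A(T)-U_B(T)\|_F\le\int_0^T\|H_A(t)-H_B(t)\|_F\,dt$, since moreover $$\|U_A(T)-U_B(T)\|_F\le d(U_A(T),U_B(T)).$$ -/

import Mathlib

attribute [local instance 100] LieRing.ofAssociativeRing
open MeasureTheory Set
open scoped Matrix Matrix.Norms.Frobenius

/-- The image `e^L` of a real Lie algebra of complex `n × n` matrices under the matrix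
exponential. -/
def expImage {n : Type*} [Fintype n] [DecidableEq n]
    (L : LieSubalgebra ℝ (Matrix n n ℂ)) : Set (Matrix n n ℂ) :=
  {U | ∃ C ∈ L, NormedSpace.exp C = U}

/-- The Frobenius norms of all generators `C ∈ L` with `e^C = U₁ U₂⁻¹`. -/
def generatorNorms {n : Type*} [Fintype n] [DecidableEq n]
    (L : LieSubalgebra ℝ (Matrix n n ℂ)) (U₁ U₂ : Matrix n n ℂ) : Set ℝ :=
  {r | ∃ C ∈ L, NormedSpace.exp C = U₁ * U₂⁻¹ ∧ ‖C‖ = r}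

/-- The metric `d(U₁, U₂) = min {‖C‖_F | C ∈ L, e^C = U₁ U₂⁻¹}` attached to `L`. It is written as an
infimum; that the minimum exists has to be claimed separately, as
`IsLeast (generatorNorms L U₁ U₂) (unitaryDist L U₁ U₂)`. -/
noncomputable def unitaryDist {n : Type*} [Fintype n] [DecidableEq n]
    (L : LieSubalgebra ℝ (Matrix n n ℂ)) (U₁ U₂ : Matrix n n ℂ) : ℝ :=
  sInf (generatorNorms L U₁ U₂)

/-- `H` is piecewise continuous on `[0, ∞)`: each bounded interval contains finitely many
discontinuities. One-sided limits at those are not required. -/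
def IsPiecewiseContinuous {n : Type*} (H : ℝ → Matrix n n ℂ) : Prop :=
  ∀ T : ℝ, {t ∈ Icc 0 T | ¬ ContinuousAt H t}.Finite

/-- `H` is bounded on every bounded interval `[0, T]`. -/
def IsBoundedOnIntervals {n : Type*} [Fintype n] (H : ℝ → Matrix n n ℂ) : Prop :=
  ∀ T : ℝ, ∃ M : ℝ, ∀ t ∈ Icc 0 T, ‖H t‖ ≤ M

/-- `U` solves `i U'(t) = H(t) U(t)`, `U(0) = I` on `[0, ∞)`. As usual for a piecewise continuous `H`,
the solution is continuous and the equation is required off the discontinuities of `H`. -/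
structure IsPropagator {n : Type*} [Fintype n] [DecidableEq n]
    (H U : ℝ → Matrix n n ℂ) : Prop where
  initial : U 0 = 1
  continuousOn : ContinuousOn U (Ici 0)
  schroedinger : ∀ t : ℝ, 0 < t → ContinuousAt H t →
    HasDerivAt U (-(Complex.I • (H t * U t))) t

/-! ### Derivative of the exponential, and the Gauss lemma on a commutator-closed subspace. -/

section BanachAlgebra

attribute [local instance 50] LieRing.toAddCommGroup

open NormedSpace Filter Topology

variable {𝔸 : Type*} [NormedRing 𝔸] [NormedAlgebra ℝ 𝔸] [CompleteSpace 𝔸]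

/-! In the interaction picture, `W = U_Bᴴ U_A` solves `W' = K W`, where `K` is `-i(H_A - H_B)`
conjugated by `U_Bᴴ`; it stays in `L` and keeps its norm. So it is enough that an evolution driven
by `K` from the identity ends at some `exp C` with `C ∈ L` and `‖C‖ ≤ ∫ ‖K‖`.

The core is the triangle inequality `exists_exp_eq_mul`, a Hopf–Rinow argument carried out on
generators, since the group `e^L` need not be closed. The product `exp X * exp Y` is cut into many
short exponentials. Among all tuples of short generators with the same ordered product, one
minimises a weighted energy; it exists because balls in a finite-dimensional space are compact.
Inserting `exp (tZ) * exp (-tZ)` between adjacent factors gives an admissible variation: near `0`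
the exponential can be inverted along such curves, and the Gauss lemma `trace_mul_expLeftDeriv`
evaluates the first variation. Hence adjacent factors are proportional to their weights, the product
collapses to a single exponential, and the energy bounds its generator.

Continuous induction (`exists_exp_mul_eq_of_hasDerivWithinAt`) passes from products to evolutions,
at the price of an `ε` removed by compactness. The product lemma also glues the evolution across
discontinuities. -/

theorem continuous_exp_real_algebra : Continuous (exp : 𝔸 → 𝔸) :=
  let _ : NormedAlgebra ℚ 𝔸 := NormedAlgebra.restrictScalars ℚ ℝ 𝔸
  exp_continuous

theorem exp_mul_exp_neg (X : 𝔸) : exp X * exp (-X) = 1 := by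
  let _ : NormedAlgebra ℚ 𝔸 := NormedAlgebra.restrictScalars ℚ ℝ 𝔸
  rw [← exp_add_of_commute (Commute.neg_right (Commute.refl X)), add_neg_cancel, exp_zero]

theorem exp_neg_mul_exp (X : 𝔸) : exp (-X) * exp X = 1 := by
  simpa using exp_mul_exp_neg (-X)

theorem exp_neg_smul_mul_exp_smul (t : ℝ) (X : 𝔸) : exp (t • -X) * exp (t • X) = 1 := by
  rw [smul_neg, exp_neg_mul_exp]

theorem exp_smul_mul_exp_neg_smul (t : ℝ) (X : 𝔸) : exp (t • X) * exp (t • -X) = 1 := by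
  rw [smul_neg, exp_mul_exp_neg]

theorem exp_smul_add_smul (s t : ℝ) (X : 𝔸) :
    exp ((s + t) • X) = exp (s • X) * exp (t • X) := by
  let _ : NormedAlgebra ℚ 𝔸 := NormedAlgebra.restrictScalars ℚ ℝ 𝔸
  rw [add_smul, exp_add_of_commute]
  exact ((Commute.refl X).smul_left s).smul_right t

/-- Duhamel's formula. -/
theorem exp_neg_mul_exp_add (Y H : 𝔸) :
    exp (-Y) * exp (Y + H) = 1 + ∫ s in (0 : ℝ)..1, exp (s • -Y) * H * exp (s • (Y + H)) := by
  have hd : ∀ s : ℝ, HasDerivAt (fun s : ℝ => exp (s • -Y) * exp (s • (Y + H)))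
      (exp (s • -Y) * H * exp (s • (Y + H))) s := fun s => by
    refine ((hasDerivAt_exp_smul_const (𝕂 := ℝ) (-Y) s).fun_mul
      (hasDerivAt_exp_smul_const' (𝕂 := ℝ) (Y + H) s)).congr_deriv ?_
    noncomm_ring
  have hc : Continuous fun s : ℝ => exp (s • -Y) * H * exp (s • (Y + H)) := by
    have := continuous_exp_real_algebra (𝔸 := 𝔸)
    fun_prop
  have := intervalIntegral.integral_eq_sub_of_hasDerivAt (fun s _ => hd s)
    (hc.intervalIntegrable 0 1)
  rw [this]
  simp

/-- The left-trivialised derivative of the exponential at `Y` in the direction `H`. -/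
noncomputable def expLeftDeriv (Y H : 𝔸) : 𝔸 :=
  ∫ s in (0 : ℝ)..1, exp (s • -Y) * H * exp (s • Y)

theorem expLeftDeriv_zero (H : 𝔸) : expLeftDeriv 0 H = H := by
  simp [expLeftDeriv]

/-- By Duhamel's formula the difference quotient equals `exp Y * c ε` with `c` continuous and `c 0 =
expLeftDeriv Y H`. -/
theorem hasDerivAt_exp_add_smul (Y H : 𝔸) :
    HasDerivAt (fun ε : ℝ => exp (Y + ε • H)) (exp Y * expLeftDeriv Y H) 0 := by
  let c : ℝ → 𝔸 := fun ε => ∫ s in (0 : ℝ)..1, exp (s • -Y) * H * exp (s • (Y + ε • H))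
  have hE := continuous_exp_real_algebra (𝔸 := 𝔸)
  have hc : Continuous c := by
    apply intervalIntegral.continuous_parametric_intervalIntegral_of_continuous' _ 0 1
    fun_prop
  have hf : ∀ ε : ℝ, exp (Y + ε • H) = exp Y + ε • (exp Y * c ε) := fun ε => by
    have h := exp_neg_mul_exp_add Y (ε • H)
    simp only [mul_smul_comm, smul_mul_assoc, intervalIntegral.integral_smul] at h
    have h2 := congrArg (fun a => exp Y * a) h
    simp only [← mul_assoc, exp_mul_exp_neg, one_mul] at h2
    rw [h2, mul_add, mul_one, mul_smul_comm]
  have h0 : c 0 = expLeftDeriv Y H := by simp [c, expLeftDeriv]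
  rw [hasDerivAt_iff_tendsto_slope, ← h0]
  have : Tendsto (fun ε => exp Y * c ε) (𝓝[≠] 0) (𝓝 (exp Y * c 0)) :=
    ((continuous_const.mul hc).tendsto 0).mono_left nhdsWithin_le_nhds
  refine this.congr' ?_
  filter_upwards [self_mem_nhdsWithin] with ε hε
  rw [slope_def_module, hf ε, hf 0]
  simp [smul_smul, inv_mul_cancel₀ (show ε ≠ 0 from hε)]

theorem contDiff_exp_real_algebra {m : WithTop ℕ∞} : ContDiff ℝ m (exp : 𝔸 → 𝔸) :=
  contDiff_iff_contDiffAt.2 fun x => (exp_analytic (𝕂 := ℝ) x).contDiffAt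

theorem fderiv_exp_apply (Y H : 𝔸) : fderiv ℝ exp Y H = exp Y * expLeftDeriv Y H := by
  have h1 : HasFDerivAt exp (fderiv ℝ exp Y) (Y + (0 : ℝ) • H) := by
    rw [zero_smul, add_zero]
    exact (contDiff_exp_real_algebra.differentiable one_ne_zero Y).hasFDerivAt
  have h2 : HasDerivAt (fun ε : ℝ => Y + ε • H) H 0 := by
    simpa using ((hasDerivAt_id (0 : ℝ)).smul_const H).const_add Y
  exact (h1.comp_hasDerivAt 0 h2).unique (hasDerivAt_exp_add_smul Y H)

theorem exists_linear_flow {E : Type*} [NormedAddCommGroup E] [NormedSpace ℝ E] [CompleteSpace E]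
    (B : E →L[ℝ] E) (y : E) : ∃ γ : ℝ → E, γ 0 = y ∧ ∀ s, HasDerivAt γ (B (γ s)) s :=
  ⟨fun s => exp (s • B) y, by simp, fun s => by
    simpa using (hasDerivAt_exp_smul_const' (𝕂 := ℝ) B s).clm_apply (hasDerivAt_const s y)⟩

/-- A real subspace of a Banach algebra that is closed under commutators and on which the norm comes
from a continuous trace and is invariant under the group generated by its exponentials. -/
structure IsSkewLieSubspace (S : Submodule ℝ 𝔸) (τ : 𝔸 →L[ℝ] ℝ) : Prop where
  commutator_mem : ∀ X ∈ S, ∀ Y ∈ S, X * Y - Y * X ∈ S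
  trace_mul_comm : ∀ a b, τ (a * b) = τ (b * a)
  norm_sq : ∀ X ∈ S, ‖X‖ ^ 2 = -τ (X * X)
  norm_exp_mul : ∀ X ∈ S, ∀ a, ‖exp X * a‖ = ‖a‖

namespace IsSkewLieSubspace

variable {S : Submodule ℝ 𝔸} {τ : 𝔸 →L[ℝ] ℝ}

/-- The flow of `ad X` restricted to `S` never leaves `S`. Undoing it by conjugation with `exp (s •
X)` gives a constant, so its value at time 1 is the conjugate of `Y`. -/
theorem exp_conj_mem [FiniteDimensional ℝ S] (hS : IsSkewLieSubspace S τ) {X Y : 𝔸} (hX : X ∈ S) (hY : Y ∈ S) :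
    exp X * Y * exp (-X) ∈ S := by
  let A : S →ₗ[ℝ] S :=
    { toFun := fun Z => ⟨X * Z - Z * X, hS.commutator_mem X hX Z Z.2⟩
      map_add' := fun Z W => Subtype.ext <| by
        simp only [Submodule.coe_add]; noncomm_ring
      map_smul' := fun r Z => Subtype.ext <| by
        simp [smul_sub] }
  let B : S →L[ℝ] S := LinearMap.toContinuousLinearMap A
  let y : S := ⟨Y, hY⟩
  obtain ⟨γ, hγ0, hγ⟩ := exists_linear_flow B y
  have hγ' : ∀ s : ℝ, HasDerivAt (fun s : ℝ => (γ s : 𝔸)) (X * γ s - γ s * X) s := fun s =>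
    S.subtypeL.hasFDerivAt.comp_hasDerivAt s (hγ s)
  have hd : ∀ s : ℝ, HasDerivAt
      (fun s : ℝ => exp (s • -X) * (γ s : 𝔸) * exp (s • X)) 0 s := fun s => by
    refine (((hasDerivAt_exp_smul_const (𝕂 := ℝ) (-X) s).fun_mul (hγ' s)).fun_mul
      (hasDerivAt_exp_smul_const' (𝕂 := ℝ) X s)).congr_deriv ?_
    noncomm_ring
  have hc := is_const_of_deriv_eq_zero (fun s => (hd s).differentiableAt) (fun s => (hd s).deriv) 1 0
  simp only [one_smul, zero_smul, exp_zero, one_mul, mul_one, hγ0] at hc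
  have : exp X * Y * exp (-X) = γ 1 := by
    have hy : (y : 𝔸) = Y := rfl
    rw [← hy, ← hc]
    simp only [← mul_assoc, exp_mul_exp_neg, one_mul]
    rw [mul_assoc, exp_mul_exp_neg, mul_one]
  rw [this]
  exact Subtype.coe_prop _

theorem expLeftDeriv_mem [FiniteDimensional ℝ S] (hS : IsSkewLieSubspace S τ) {X Y : 𝔸} (hX : X ∈ S) (hY : Y ∈ S) :
    expLeftDeriv X Y ∈ S := by
  let f : ℝ → S := fun s => ⟨exp (s • -X) * Y * exp (s • X), by
    simpa using hS.exp_conj_mem (S.smul_mem s (S.neg_mem hX)) hY⟩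
  have hf : Continuous f := by
    have hE := continuous_exp_real_algebra (𝔸 := 𝔸)
    exact Continuous.subtype_mk (by fun_prop) _
  have := S.subtypeL.intervalIntegral_comp_comm (hf.intervalIntegrable (μ := volume) 0 1)
  have h2 : expLeftDeriv X Y = S.subtypeL (∫ s in (0 : ℝ)..1, f s) := this
  rw [h2]
  exact Subtype.coe_prop _

/-- The Gauss lemma for the exponential map. -/
theorem trace_mul_expLeftDeriv (hS : IsSkewLieSubspace S τ) (X Y : 𝔸) :
    τ (X * expLeftDeriv X Y) = τ (X * Y) := by
  have hE := continuous_exp_real_algebra (𝔸 := 𝔸)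
  have hf : Continuous fun s : ℝ => exp (s • -X) * Y * exp (s • X) := by fun_prop
  have h := (τ.comp (ContinuousLinearMap.mul ℝ 𝔸 X)).intervalIntegral_comp_comm
    (hf.intervalIntegrable (μ := volume) 0 1)
  change _ = τ (X * expLeftDeriv X Y) at h
  rw [← h]
  have h2 : ∀ s : ℝ, (τ.comp (ContinuousLinearMap.mul ℝ 𝔸 X)) (exp (s • -X) * Y * exp (s • X)) =
      τ (X * Y) := fun s => by
    have hcomm : X * exp (s • -X) = exp (s • -X) * X := by
      let _ : NormedAlgebra ℚ 𝔸 := NormedAlgebra.restrictScalars ℚ ℝ 𝔸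
      exact (((Commute.refl X).neg_right.smul_right s).exp_right).eq
    calc τ (X * (exp (s • -X) * Y * exp (s • X)))
        = τ ((X * exp (s • -X) * Y) * exp (s • X)) := by simp only [mul_assoc]
      _ = τ (exp (s • X) * (X * exp (s • -X) * Y)) := hS.trace_mul_comm _ _
      _ = τ (exp (s • X) * exp (s • -X) * (X * Y)) := by rw [hcomm]; simp only [mul_assoc]
      _ = τ (X * Y) := by rw [exp_smul_mul_exp_neg_smul, one_mul]
  simp only [h2]
  simp

end IsSkewLieSubspace

end BanachAlgebra

/-! ### Lifting one-parameter multiplications to curves of generators. -/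

section LocalLogarithm

open NormedSpace Filter Topology

attribute [local instance 50] LieRing.toAddCommGroup

variable {𝔸 : Type*} [NormedRing 𝔸] [NormedAlgebra ℝ 𝔸] [FiniteDimensional ℝ 𝔸] [CompleteSpace 𝔸]

namespace IsSkewLieSubspace

variable {S : Submodule ℝ 𝔸} {τ : 𝔸 →L[ℝ] ℝ}

/-- Viewed as operators on `S`, the derivatives of the exponential can be inverted near `0`, and the
`C¹` dependence on the base point makes the inverse a vector field to which Picard–Lindelöf applies.
Smoothness is read off from `exp (-Y) * fderiv ℝ exp Y`, followed by a linear projection onto `S`.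
-/
theorem exists_contDiff_expLeftDeriv (hS : IsSkewLieSubspace S τ) :
    ∃ G : S → S →L[ℝ] S, ContDiff ℝ 1 G ∧ ∀ Y H : S, (G Y H : 𝔸) = expLeftDeriv (Y : 𝔸) H := by
  obtain ⟨g, hg⟩ := S.subtype.exists_leftInverse_of_injective S.ker_subtype
  let P : 𝔸 →L[ℝ] S := LinearMap.toContinuousLinearMap g
  have hP : ∀ x : S, P x = x := fun x => LinearMap.congr_fun hg x
  refine ⟨fun Y => P ∘L (ContinuousLinearMap.mul ℝ 𝔸 (exp (-(Y : 𝔸)))) ∘L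
    (fderiv ℝ exp (Y : 𝔸)) ∘L S.subtypeL, ?_, fun Y H => ?_⟩
  · have h1 : ContDiff ℝ 1 fun Y : S => (Y : 𝔸) := S.subtypeL.contDiff
    have h2 : ContDiff ℝ 1 fun Y : S => fderiv ℝ exp (Y : 𝔸) :=
      ((contDiff_exp_real_algebra (m := 2)).fderiv_right (by norm_num)).comp h1
    have h3 : ContDiff ℝ 1 fun Y : S => ContinuousLinearMap.mul ℝ 𝔸 (exp (-(Y : 𝔸))) :=
      (ContinuousLinearMap.mul ℝ 𝔸).contDiff.comp (contDiff_exp_real_algebra.comp h1.neg)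
    exact contDiff_const.clm_comp (h3.clm_comp (h2.clm_comp contDiff_const))
  · have : exp (-(Y : 𝔸)) * (exp (Y : 𝔸) * expLeftDeriv (Y : 𝔸) H) = expLeftDeriv (Y : 𝔸) H := by
      rw [← mul_assoc, exp_neg_mul_exp, one_mul]
    simp only [ContinuousLinearMap.comp_apply, fderiv_exp_apply, Submodule.subtypeL_apply,
      ContinuousLinearMap.mul_apply', this]
    exact congrArg Subtype.val (hP ⟨_, hS.expLeftDeriv_mem Y.2 H.2⟩)

/-- Near the origin, right multiplication of `exp X` by a one-parameter group lifts to a curve of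
generators, and the lift does not change the radial component of the velocity. -/
theorem exists_lift_exp_mul_exp_smul (hS : IsSkewLieSubspace S τ) :
    ∃ δ > 0, ∀ X ∈ S, ‖X‖ < δ → ∀ Z ∈ S, ∃ α : ℝ → 𝔸, (∀ t, α t ∈ S) ∧ α 0 = X ∧
      (∃ v, HasDerivAt α v 0 ∧ τ (X * v) = τ (X * Z)) ∧
      ∀ᶠ t in 𝓝 0, exp (α t) = exp X * exp (t • Z) := by
  obtain ⟨G, hG, hGe⟩ := hS.exists_contDiff_expLeftDeriv
  have hG0 : G 0 = (ContinuousLinearEquiv.refl ℝ S : S →L[ℝ] S) := by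
    ext H
    simp [hGe, expLeftDeriv_zero]
  -- Invertible operators form an open set, and `G 0` is the identity.
  have hinv : ∀ᶠ Y in 𝓝 (0 : S), ∃ e : S ≃L[ℝ] S, (e : S →L[ℝ] S) = G Y := by
    have := (ContinuousLinearEquiv.refl ℝ S).nhds
    rw [← hG0] at this
    exact hG.continuous.continuousAt this
  obtain ⟨δ, hδ, hball⟩ := Metric.eventually_nhds_iff_ball.1 hinv
  refine ⟨δ, hδ, fun X hX hXδ Z hZ => ?_⟩
  let x : S := ⟨X, hX⟩
  let z : S := ⟨Z, hZ⟩
  have hx : x ∈ Metric.ball (0 : S) δ := by simpa [x] using hXδ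
  -- Along an integral curve of `F` the left logarithmic derivative of `exp ∘ α` is constantly `Z`,
  -- which forces `exp (α t) = exp X * exp (t • Z)`.
  let F : S → S := fun Y => (G Y).inverse z
  have hGF : ∀ Y ∈ Metric.ball (0 : S) δ, G Y (F Y) = z := fun Y hY => by
    obtain ⟨e, he⟩ := hball Y hY
    simp [F, ← he]
  have hF : ContDiffAt ℝ 1 F x := by
    obtain ⟨e, he⟩ := hball x hx
    have h := contDiffAt_map_inverse (𝕜 := ℝ) (n := 1) e
    rw [he] at h
    exact (h.comp x hG.contDiffAt).clm_apply contDiffAt_const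
  obtain ⟨α, hα0, ε, hε, hα⟩ :=
    hF.exists_forall_mem_closedBall_exists_eq_forall_mem_Ioo_hasDerivAt₀ 0
  simp only [zero_sub, zero_add] at hα
  have hcont : ContinuousAt α 0 := (hα 0 ⟨by linarith, hε⟩).continuousAt
  have hev : ∀ᶠ t in 𝓝 (0 : ℝ), α t ∈ Metric.ball (0 : S) δ :=
    hcont (Metric.isOpen_ball.mem_nhds (hα0 ▸ hx))
  have hev2 : ∀ᶠ t in 𝓝 (0 : ℝ), t ∈ Ioo (-ε) ε := Ioo_mem_nhds (by linarith) hε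
  obtain ⟨η, hη, hηb⟩ := Metric.eventually_nhds_iff_ball.1 (hev.and hev2)
  have hα' : ∀ t ∈ Metric.ball (0 : ℝ) η, HasDerivAt (fun t => (α t : 𝔸)) (F (α t)) t :=
    fun t ht => S.subtypeL.hasFDerivAt.comp_hasDerivAt t (hα t (hηb t ht).2)
  have h0 : (0 : ℝ) ∈ Metric.ball (0 : ℝ) η := Metric.mem_ball_self hη
  have hlog : ∀ t ∈ Metric.ball (0 : ℝ) η, expLeftDeriv (α t : 𝔸) (F (α t)) = Z := fun t ht => by
    rw [← hGe, hGF _ (hηb t ht).1]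
  refine ⟨fun t => α t, fun t => (α t).2, by simp [hα0, x], ⟨F (α 0), hα' 0 h0, ?_⟩, ?_⟩
  · have := hS.trace_mul_expLeftDeriv (α 0 : 𝔸) (F (α 0))
    rw [hlog 0 h0, hα0] at this
    rw [hα0]
    exact this.symm
  · have hd : ∀ t ∈ Metric.ball (0 : ℝ) η,
        HasDerivAt (fun t => exp (α t : 𝔸) * exp (t • -Z)) 0 t := fun t ht => by
      have h1 : HasFDerivAt exp (fderiv ℝ exp (α t : 𝔸)) (α t : 𝔸) :=
        (contDiff_exp_real_algebra.differentiable one_ne_zero _).hasFDerivAt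
      have h2 := h1.comp_hasDerivAt t (hα' t ht)
      rw [fderiv_exp_apply, hlog t ht] at h2
      refine (h2.fun_mul (hasDerivAt_exp_smul_const' (𝕂 := ℝ) (-Z) t)).congr_deriv ?_
      simp only [Function.comp_apply]
      noncomm_ring
    filter_upwards [Metric.ball_mem_nhds (0 : ℝ) hη] with t ht
    have hc := Metric.isOpen_ball.is_const_of_deriv_eq_zero
      ((convex_ball (0 : ℝ) η).isPreconnected)
      (fun s hs => (hd s hs).differentiableAt.differentiableWithinAt)
      (fun s hs => (hd s hs).deriv) ht h0
    simp only [hα0, zero_smul, exp_zero, mul_one] at hc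
    change _ = exp X at hc
    rw [← hc, mul_assoc, exp_neg_smul_mul_exp_smul, mul_one]

/-- The counterpart of `exists_lift_exp_mul_exp_smul` for left multiplication. -/
theorem exists_lift_exp_neg_smul_mul_exp (hS : IsSkewLieSubspace S τ) :
    ∃ δ > 0, ∀ Y ∈ S, ‖Y‖ < δ → ∀ Z ∈ S, ∃ β : ℝ → 𝔸, (∀ t, β t ∈ S) ∧ β 0 = Y ∧
      (∃ v, HasDerivAt β v 0 ∧ τ (Y * v) = -τ (Y * Z)) ∧
      ∀ᶠ t in 𝓝 0, exp (β t) = exp (t • -Z) * exp Y := by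
  -- Inversion exchanges left and right multiplication: lift `exp (-Y) * exp (t • Z)` and change the
  -- sign of the curve.
  obtain ⟨δ, hδ, h⟩ := hS.exists_lift_exp_mul_exp_smul
  refine ⟨δ, hδ, fun Y hY hYδ Z hZ => ?_⟩
  obtain ⟨α, hα, hα0, ⟨v, hv, hvτ⟩, he⟩ := h (-Y) (S.neg_mem hY) (by simpa using hYδ) Z hZ
  refine ⟨fun t => -α t, fun t => S.neg_mem (hα t), by simp [hα0], ⟨-v, hv.fun_neg, ?_⟩, ?_⟩
  · simpa using hvτ
  · filter_upwards [he] with t ht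
    calc exp (-α t) = exp (-α t) * (exp (-Y) * exp (t • Z) * (exp (t • -Z) * exp Y)) := by
          rw [mul_assoc (exp (-Y)), ← mul_assoc (exp (t • Z)), exp_smul_mul_exp_neg_smul, one_mul,
            exp_neg_mul_exp, mul_one]
      _ = exp (t • -Z) * exp Y := by
          rw [← ht, ← mul_assoc, exp_neg_mul_exp, one_mul]

end IsSkewLieSubspace

end LocalLogarithm

/-! ### Energy minimisation and the triangle inequality for generators. -/

section Concatenation

open NormedSpace Filter Topology

attribute [local instance 50] LieRing.toAddCommGroup

variable {𝔸 : Type*} [NormedRing 𝔸]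

/-- The ordered product `exp (K 0) * ⋯ * exp (K (m - 1))`. -/
noncomputable def expProd (K : ℕ → 𝔸) : ℕ → 𝔸
  | 0 => 1
  | m + 1 => expProd K m * exp (K m)

theorem expProd_congr {K K' : ℕ → 𝔸} {m : ℕ} (h : ∀ i < m, K i = K' i) :
    expProd K m = expProd K' m := by
  induction m with
  | zero => rfl
  | succ m ih => rw [expProd, expProd, ih fun i hi => h i (by omega), h m (by omega)]

theorem hasDerivAt_trace_mul_self [NormedAlgebra ℝ 𝔸] {τ : 𝔸 →L[ℝ] ℝ} (hτ : ∀ a b, τ (a * b) = τ (b * a))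
    {α : ℝ → 𝔸} {v : 𝔸} {t : ℝ} (hα : HasDerivAt α v t) :
    HasDerivAt (fun s => τ (α s * α s)) (2 * τ (α t * v)) t := by
  refine (τ.hasFDerivAt.comp_hasDerivAt t (hα.fun_mul hα)).congr_deriv ?_
  rw [map_add, hτ v]
  ring

theorem expProd_eq_of_pair {K K' : ℕ → 𝔸} {i m : ℕ} (hm : i + 2 ≤ m)
    (h : ∀ j, j ≠ i → j ≠ i + 1 → K' j = K j)
    (hi : exp (K' i) * exp (K' (i + 1)) = exp (K i) * exp (K (i + 1))) :
    expProd K' m = expProd K m := by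
  induction m, hm using Nat.le_induction with
  | base =>
    rw [expProd, expProd, expProd, expProd, mul_assoc, mul_assoc, hi,
      expProd_congr fun j hj => h j (by omega) (by omega)]
  | succ m hm ih => rw [expProd, expProd, ih, h m (by omega) (by omega)]

variable [NormedAlgebra ℝ 𝔸] [CompleteSpace 𝔸]

theorem continuous_expProd (m : ℕ) : Continuous fun K : ℕ → 𝔸 => expProd K m := by
  induction m with
  | zero => exact continuous_const
  | succ m ih => exact ih.mul (continuous_exp_real_algebra.comp (continuous_apply m))

theorem expProd_eq_exp_sum {K : ℕ → 𝔸} {w : ℕ → ℝ} {Q : 𝔸} {m : ℕ}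
    (h : ∀ i < m, K i = w i • Q) : expProd K m = exp ((∑ i ∈ Finset.range m, w i) • Q) := by
  induction m with
  | zero => simp [expProd]
  | succ m ih =>
    rw [expProd, ih fun i hi => h i (by omega), Finset.sum_range_succ, exp_smul_add_smul,
      h m (by omega)]

theorem expProd_add_const {K : ℕ → 𝔸} {Z : 𝔸} {m k : ℕ} (h : ∀ j < k, K (m + j) = Z) :
    expProd K (m + k) = expProd K m * exp ((k : ℝ) • Z) := by
  induction k with
  | zero => simp
  | succ k ih =>
    rw [← add_assoc, expProd, ih fun j hj => h j (by omega), h k (by omega), mul_assoc,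
      Nat.cast_succ, exp_smul_add_smul, one_smul]

theorem sum_range_sub_of_pair {M : Type*} {K K' : ℕ → M} (g : ℕ → M → ℝ) {i m : ℕ}
    (hm : i + 2 ≤ m) (h : ∀ j, j ≠ i → j ≠ i + 1 → K' j = K j) :
    ∑ j ∈ Finset.range m, g j (K' j) - ∑ j ∈ Finset.range m, g j (K j) =
      (g i (K' i) + g (i + 1) (K' (i + 1))) - (g i (K i) + g (i + 1) (K (i + 1))) := by
  rw [← Finset.sum_sub_distrib]
  have hsub : ({i, i + 1} : Finset ℕ) ⊆ Finset.range m := by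
    intro j hj
    simp only [Finset.mem_insert, Finset.mem_singleton] at hj
    exact Finset.mem_range.2 (by omega)
  rw [← Finset.sum_subset hsub, Finset.sum_pair (by omega)]
  · ring
  · intro j _ hj
    simp only [Finset.mem_insert, Finset.mem_singleton, not_or] at hj
    rw [h j hj.1 hj.2, sub_self]

namespace IsSkewLieSubspace

variable {S : Submodule ℝ 𝔸} {τ : 𝔸 →L[ℝ] ℝ} [FiniteDimensional ℝ 𝔸]

/-- Consecutive factors of a product of short exponentials that minimises the weighted energy are
proportional to their weights. -/
theorem exists_expProd_balanced (hS : IsSkewLieSubspace S τ) :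
    ∃ δ > 0, ∀ (K : ℕ → 𝔸) (w : ℕ → ℝ) (i m : ℕ), i + 2 ≤ m → (∀ j, K j ∈ S) →
      (∀ j, 0 < w j) → ‖K i‖ < δ → ‖K (i + 1)‖ < δ →
      (∀ K' : ℕ → 𝔸, (∀ j, K' j ∈ S) → (∀ j, j ≠ i → j ≠ i + 1 → K' j = K j) →
        ‖K' i‖ < δ → ‖K' (i + 1)‖ < δ → expProd K' m = expProd K m →
        ∑ j ∈ Finset.range m, ‖K j‖ ^ 2 / w j ≤ ∑ j ∈ Finset.range m, ‖K' j‖ ^ 2 / w j) →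
      (w i)⁻¹ • K i = (w (i + 1))⁻¹ • K (i + 1) := by
  obtain ⟨δ₁, hδ₁, h₁⟩ := hS.exists_lift_exp_mul_exp_smul
  obtain ⟨δ₂, hδ₂, h₂⟩ := hS.exists_lift_exp_neg_smul_mul_exp
  refine ⟨min δ₁ δ₂, lt_min hδ₁ hδ₂, fun K w i m him hK hw hKi hKi' hmin => ?_⟩
  -- The variation moves along the defect itself: the derivative of the energy at `t = 0` is then
  -- `-2 τ (Z * Z) = 2 ‖Z‖ ^ 2`, so minimality forces `Z = 0`.
  let Z : 𝔸 := (w i)⁻¹ • K i - (w (i + 1))⁻¹ • K (i + 1)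
  have hZ : Z ∈ S := S.sub_mem (S.smul_mem _ (hK i)) (S.smul_mem _ (hK (i + 1)))
  obtain ⟨α, hα, hα0, ⟨u, hu, huτ⟩, hαe⟩ :=
    h₁ (K i) (hK i) (hKi.trans_le (min_le_left _ _)) Z hZ
  obtain ⟨β, hβ, hβ0, ⟨v, hv, hvτ⟩, hβe⟩ :=
    h₂ (K (i + 1)) (hK (i + 1)) (hKi'.trans_le (min_le_right _ _)) Z hZ
  let f : ℝ → ℝ := fun t => -τ (α t * α t) / w i + -τ (β t * β t) / w (i + 1)
  have hf : HasDerivAt f (-(2 * τ (α 0 * u)) / w i + -(2 * τ (β 0 * v)) / w (i + 1)) 0 :=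
    (((hasDerivAt_trace_mul_self hS.trace_mul_comm hu).fun_neg).div_const _).add
      (((hasDerivAt_trace_mul_self hS.trace_mul_comm hv).fun_neg).div_const _)
  have hsmallα : ∀ᶠ t in 𝓝 (0 : ℝ), ‖α t‖ < min δ₁ δ₂ :=
    (hu.continuousAt.norm).eventually_lt_const (by simpa only [hα0] using hKi)
  have hsmallβ : ∀ᶠ t in 𝓝 (0 : ℝ), ‖β t‖ < min δ₁ δ₂ :=
    (hv.continuousAt.norm).eventually_lt_const (by simpa only [hβ0] using hKi')
  have hlocal : IsLocalMin f 0 := by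
    filter_upwards [hαe, hβe, hsmallα, hsmallβ] with t hαt hβt hsα hsβ
    let K' : ℕ → 𝔸 := fun j => if j = i then α t else if j = i + 1 then β t else K j
    have hK'i : K' i = α t := if_pos rfl
    have hK'i' : K' (i + 1) = β t := by simp [K']
    have hK' : ∀ j, j ≠ i → j ≠ i + 1 → K' j = K j := fun j hj hj' => by simp [K', hj, hj']
    have hmem : ∀ j, K' j ∈ S := fun j => by
      simp only [K']
      split_ifs
      exacts [hα t, hβ t, hK j]
    have hpair : exp (K' i) * exp (K' (i + 1)) = exp (K i) * exp (K (i + 1)) := by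
      rw [hK'i, hK'i', hαt, hβt, mul_assoc, ← mul_assoc (exp (t • Z)), exp_smul_mul_exp_neg_smul,
        one_mul]
    have hle := hmin K' hmem hK' (by rwa [hK'i]) (by rwa [hK'i'])
      (expProd_eq_of_pair him hK' hpair)
    have hsum := sum_range_sub_of_pair (fun j x => ‖x‖ ^ 2 / w j) him hK'
    simp only [hK'i, hK'i'] at hsum
    have e1 := hS.norm_sq _ (hα t)
    have e2 := hS.norm_sq _ (hβ t)
    have e3 := hS.norm_sq _ (hK i)
    have e4 := hS.norm_sq _ (hK (i + 1))
    simp only [f, hα0, hβ0]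
    rw [← e1, ← e2, ← e3, ← e4]
    linarith
  have h0 := hlocal.hasDerivAt_eq_zero hf
  rw [hα0, hβ0, huτ, hvτ] at h0
  have hZ2 : ‖Z‖ ^ 2 = 0 := by
    have hexp : τ (Z * Z) = τ (K i * Z) / w i - τ (K (i + 1) * Z) / w (i + 1) := by
      conv_lhs => rw [show Z * Z = (w i)⁻¹ • (K i * Z) - (w (i + 1))⁻¹ • (K (i + 1) * Z) by
        simp only [← smul_mul_assoc, ← sub_mul]; rfl]
      rw [map_sub, map_smul, map_smul, smul_eq_mul, smul_eq_mul]
      ring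
    rw [hS.norm_sq Z hZ, hexp]
    linear_combination h0 / 2
  exact sub_eq_zero.1 (norm_eq_zero.1 (pow_eq_zero_iff two_ne_zero |>.1 hZ2))

/-- Direct method: a minimiser of `∑ ‖K j‖ ^ 2 / w j` at fixed product has all `K j = w j • Q`, so
the product is `exp (W • Q)` with `W = ∑ w j` and energy `‖Q‖ ^ 2 * W`. Comparison with the initial
tuple gives `‖Q‖ ≤ η`. The bound `η * c < δ` makes that tuple admissible; the last smallness
hypothesis keeps the minimiser off the boundary. -/
theorem exists_exp_eq_expProd (hS : IsSkewLieSubspace S τ) :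
    ∃ δ > 0, ∀ (K : ℕ → 𝔸) (w : ℕ → ℝ) (m : ℕ) (η c : ℝ), 0 < m → (∀ j, K j ∈ S) →
      (∀ j, 0 < w j) → (∀ j, w j ≤ c) → 0 ≤ η → (∀ j, ‖K j‖ ≤ η * w j) → η * c < δ →
      c * (η ^ 2 * ∑ j ∈ Finset.range m, w j) < δ ^ 2 →
      ∃ C ∈ S, exp C = expProd K m ∧ ‖C‖ ≤ η * ∑ j ∈ Finset.range m, w j := by
  obtain ⟨δ, hδ, hbal⟩ := hS.exists_expProd_balanced
  refine ⟨δ, hδ, fun K₀ w m η c hm hK₀ hw hwc hη hK₀w hηc hsmall => ?_⟩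
  let E : (ℕ → 𝔸) → ℝ := fun K => ∑ j ∈ Finset.range m, ‖K j‖ ^ 2 / w j
  -- All coordinates are confined, including those beyond `m`, so that Tychonoff applies to whole
  -- sequences.
  let B : Set (ℕ → 𝔸) := univ.pi fun _ => (S : Set 𝔸) ∩ Metric.closedBall 0 δ
  let D : Set (ℕ → 𝔸) := B ∩ {K | expProd K m = expProd K₀ m}
  have : ProperSpace 𝔸 := FiniteDimensional.proper ℝ 𝔸
  have hSc : IsClosed (S : Set 𝔸) := S.closed_of_finiteDimensional
  have hD : IsCompact D :=
    (isCompact_univ_pi fun _ => (isCompact_closedBall (0 : 𝔸) δ).inter_left hSc).inter_right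
      (isClosed_eq (continuous_expProd m) continuous_const)
  have hE : Continuous E := by
    refine continuous_finsetSum _ fun j _ => ?_
    exact ((continuous_apply j).norm.pow 2).div_const _
  have hmemB : ∀ K : ℕ → 𝔸, (∀ j, K j ∈ S) → (∀ j, ‖K j‖ ≤ δ) → K ∈ B := fun K h1 h2 j _ =>
    ⟨h1 j, by simpa using h2 j⟩
  have hc : 0 < c := (hw 0).trans_le (hwc 0)
  have hK₀D : K₀ ∈ D := ⟨hmemB K₀ hK₀ fun j => (hK₀w j).trans
    ((mul_le_mul_of_nonneg_left (hwc j) hη).trans hηc.le), rfl⟩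
  obtain ⟨K, hKD, hKmin⟩ := hD.exists_isMinOn ⟨K₀, hK₀D⟩ hE.continuousOn
  have hKS : ∀ j, K j ∈ S := fun j => (hKD.1 j trivial).1
  have hKδ : ∀ j, ‖K j‖ ≤ δ := fun j => by simpa using (hKD.1 j trivial).2
  have hEK : E K ≤ η ^ 2 * ∑ j ∈ Finset.range m, w j := by
    refine (hKmin hK₀D).trans ?_
    rw [Finset.mul_sum]
    refine Finset.sum_le_sum fun j _ => ?_
    rw [div_le_iff₀ (hw j)]
    calc ‖K₀ j‖ ^ 2 ≤ (η * w j) ^ 2 := pow_le_pow_left₀ (norm_nonneg _) (hK₀w j) 2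
      _ = η ^ 2 * w j * w j := by ring
  -- Each term is at most the total energy, so `‖K j‖ ^ 2 ≤ E K * w j < δ ^ 2`. The strict
  -- inequality is what allows two-sided variations.
  have hlt : ∀ j < m, ‖K j‖ < δ := fun j hj => by
    have h1 : ‖K j‖ ^ 2 / w j ≤ E K := Finset.single_le_sum
      (f := fun j => ‖K j‖ ^ 2 / w j)
      (fun i _ => div_nonneg (sq_nonneg _) (hw i).le) (Finset.mem_range.2 hj)
    have h2 : ‖K j‖ ^ 2 ≤ E K * w j := (div_le_iff₀ (hw j)).1 h1
    have h3 : E K * w j ≤ (η ^ 2 * ∑ j ∈ Finset.range m, w j) * c :=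
      mul_le_mul hEK (hwc j) (hw j).le
        (mul_nonneg (sq_nonneg _) (Finset.sum_nonneg fun i _ => (hw i).le))
    refine lt_of_pow_lt_pow_left₀ 2 hδ.le ?_
    linarith
  have hstep : ∀ i, i + 2 ≤ m → (w i)⁻¹ • K i = (w (i + 1))⁻¹ • K (i + 1) := fun i hi => by
    refine hbal K w i m hi hKS hw (hlt i (by omega)) (hlt (i + 1) (by omega)) ?_
    intro K' hK'S hK' hs hs' hprod
    refine hKmin ⟨hmemB K' hK'S fun j => ?_, hprod.trans hKD.2⟩
    by_cases h1 : j = i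
    · exact h1 ▸ hs.le
    by_cases h2 : j = i + 1
    · exact h2 ▸ hs'.le
    exact hK' j h1 h2 ▸ hKδ j
  let Q : 𝔸 := (w 0)⁻¹ • K 0
  have hQ : ∀ i < m, (w i)⁻¹ • K i = Q := fun i => by
    induction i with
    | zero => exact fun _ => rfl
    | succ i ih => exact fun hi => (hstep i (by omega)).symm.trans (ih (by omega))
  have hKQ : ∀ i < m, K i = w i • Q := fun i hi => by
    rw [← hQ i hi, smul_inv_smul₀ (hw i).ne']
  have hW : 0 < ∑ j ∈ Finset.range m, w j :=
    Finset.sum_pos (fun i _ => hw i) ⟨0, Finset.mem_range.2 hm⟩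
  have hEQ : E K = ‖Q‖ ^ 2 * ∑ j ∈ Finset.range m, w j := by
    rw [Finset.mul_sum]
    refine Finset.sum_congr rfl fun j hj => ?_
    rw [hKQ j (Finset.mem_range.1 hj), norm_smul, Real.norm_of_nonneg (hw j).le]
    have := (hw j).ne'
    field_simp
  have hQη : ‖Q‖ ≤ η := by
    rw [hEQ] at hEK
    exact le_of_sq_le_sq (le_of_mul_le_mul_right hEK hW) hη
  refine ⟨(∑ j ∈ Finset.range m, w j) • Q, S.smul_mem _ (S.smul_mem _ (hKS 0)), ?_, ?_⟩
  · rw [← expProd_eq_exp_sum hKQ]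
    exact hKD.2
  · rw [norm_smul, Real.norm_of_nonneg hW.le, mul_comm]
    exact mul_le_mul_of_nonneg_right hQη hW.le

/-- The exponentials of `S` form a group, and generators of minimal norm obey the triangle
inequality. -/
theorem exists_exp_eq_mul (hS : IsSkewLieSubspace S τ) {X Y : 𝔸} (hX : X ∈ S) (hY : Y ∈ S) :
    ∃ C ∈ S, exp C = exp X * exp Y ∧ ‖C‖ ≤ ‖X‖ + ‖Y‖ := by
  rcases eq_or_ne X 0 with rfl | hX0
  · exact ⟨Y, hY, by simp, by simp⟩
  rcases eq_or_ne Y 0 with rfl | hY0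
  · exact ⟨X, hX, by simp, by simp⟩
  obtain ⟨δ, hδ, h⟩ := hS.exists_exp_eq_expProd
  have ha : 0 < ‖X‖ := norm_pos_iff.2 hX0
  have hb : 0 < ‖Y‖ := norm_pos_iff.2 hY0
  let c := ‖X‖ + ‖Y‖
  -- With `η = 1 / N` and total weight `N * c`, the two entries of the maximum are exactly what `η *
  -- c < δ` and `c * (η ^ 2 * (N * c)) < δ ^ 2` require.
  obtain ⟨N, hN⟩ := exists_nat_gt (max (c / δ) (c * c / δ ^ 2))
  have hN1 := (le_max_left _ _).trans_lt hN
  have hN2 := (le_max_right _ _).trans_lt hN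
  have hc : 0 < c := add_pos ha hb
  have hNpos : (0 : ℝ) < N := (div_pos hc hδ).trans hN1
  have hN0 : 0 < N := by exact_mod_cast hNpos
  -- Weights proportional to the lengths of the factors give every factor the same ratio `‖K j‖ / w
  -- j = 1 / N`, so the resulting bound is exactly `‖X‖ + ‖Y‖`. Positivity of the weights is why
  -- zero generators were treated apart.
  let w : ℕ → ℝ := fun j => if j < N then ‖X‖ else ‖Y‖
  let K : ℕ → 𝔸 := fun j => if j < N then (N : ℝ)⁻¹ • X else (N : ℝ)⁻¹ • Y
  have hsum : ∑ j ∈ Finset.range (N + N), w j = N * c := by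
    rw [Finset.sum_range_add, Finset.sum_congr rfl (g := fun _ => ‖X‖)
      fun j hj => if_pos (Finset.mem_range.1 hj),
      Finset.sum_congr rfl (g := fun _ => ‖Y‖) fun j _ => if_neg (by omega)]
    simp [c, mul_add]
  obtain ⟨C, hC, hCe, hCn⟩ := h K w (N + N) (N : ℝ)⁻¹ c (by omega)
    (fun j => by
      simp only [K]
      split_ifs
      exacts [S.smul_mem _ hX, S.smul_mem _ hY])
    (fun j => by
      simp only [w]
      split_ifs <;> assumption)
    (fun j => by
      simp only [w, c]
      split_ifs <;> linarith)
    (by positivity)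
    (fun j => by
      simp only [K, w]
      split_ifs <;> simp [norm_smul])
    (by
      rw [inv_mul_eq_div, div_lt_iff₀ hNpos]
      rwa [div_lt_iff₀ hδ, mul_comm] at hN1)
    (by
      rw [hsum]
      rw [div_lt_iff₀ (by positivity)] at hN2
      have : c * ((N : ℝ)⁻¹ ^ 2 * (N * c)) = c * c / N := by field_simp
      rw [this, div_lt_iff₀ hNpos]
      linarith)
  refine ⟨C, hC, ?_, ?_⟩
  · have h1 := expProd_add_const (K := K) (m := 0) (k := N) (Z := (N : ℝ)⁻¹ • X)
      fun j hj => if_pos (by omega)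
    have h2 := expProd_add_const (K := K) (m := N) (k := N) (Z := (N : ℝ)⁻¹ • Y)
      fun j _ => if_neg (by omega)
    rw [zero_add, expProd, one_mul] at h1
    rw [hCe, h2, h1, smul_inv_smul₀ hNpos.ne', smul_inv_smul₀ hNpos.ne']
  · rw [hsum, ← mul_assoc, inv_mul_cancel₀ hNpos.ne', one_mul] at hCn
    exact hCn

end IsSkewLieSubspace

end Concatenation

/-! ### From products of exponentials to time-dependent evolutions. -/

section Evolution

open NormedSpace Filter Topology

attribute [local instance 50] LieRing.toAddCommGroup

variable {𝔸 : Type*} [NormedRing 𝔸] [NormedAlgebra ℝ 𝔸] [CompleteSpace 𝔸]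

theorem ContinuousOn.eventually_dist_endpoints_lt {F : Type*} [PseudoMetricSpace F] {f : ℝ → F}
    {a b ε : ℝ} (hf : ContinuousOn f (Icc a b)) (hab : a < b) (hε : 0 < ε) :
    (∀ᶠ t in 𝓝[>] a, dist (f t) (f a) < ε) ∧ ∀ᶠ t in 𝓝[<] b, dist (f t) (f b) < ε :=
  ⟨Metric.tendsto_nhds.1 ((hf a (left_mem_Icc.2 hab.le)).mono_of_mem_nhdsWithin
      (Icc_mem_nhdsGT hab)) _ hε,
    Metric.tendsto_nhds.1 ((hf b (right_mem_Icc.2 hab.le)).mono_of_mem_nhdsWithin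
      (Icc_mem_nhdsLT hab)) _ hε⟩

namespace IsSkewLieSubspace

variable {S : Submodule ℝ 𝔸} {τ : 𝔸 →L[ℝ] ℝ}

/-- The curve `t ↦ exp (t • C)` joins `1` to `exp C` with constant speed `‖C‖`, and a chord is no
longer than its arc. -/
theorem norm_exp_sub_one_le (hS : IsSkewLieSubspace S τ) {C : 𝔸} (hC : C ∈ S) :
    ‖exp C - 1‖ ≤ ‖C‖ := by
  have := norm_image_sub_le_of_norm_deriv_le_segment_01' (f := fun t : ℝ => exp (t • C))
    (f' := fun t => exp (t • C) * C) (C := ‖C‖)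
    (fun t _ => (hasDerivAt_exp_smul_const (𝕂 := ℝ) C t).hasDerivWithinAt)
    (fun t _ => (hS.norm_exp_mul _ (S.smul_mem t hC) C).le)
  simpa using this

theorem exists_exp_eq_of_minimal_norm [FiniteDimensional ℝ 𝔸] (S : Submodule ℝ 𝔸) {V : 𝔸} (hV : ∃ C ∈ S, exp C = V) :
    ∃ C ∈ S, exp C = V ∧ ∀ C' ∈ S, exp C' = V → ‖C‖ ≤ ‖C'‖ := by
  have : ProperSpace 𝔸 := FiniteDimensional.proper ℝ 𝔸
  have hcl : IsClosed ((S : Set 𝔸) ∩ {C | exp C = V}) :=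
    S.closed_of_finiteDimensional.inter
      (isClosed_eq continuous_exp_real_algebra continuous_const)
  obtain ⟨C, hC, hCd⟩ := hcl.exists_infDist_eq_dist hV 0
  refine ⟨C, hC.1, hC.2, fun C' hC' he => ?_⟩
  have := Metric.infDist_le_dist_of_mem (x := 0) (show C' ∈ (S : Set 𝔸) ∩ {C | exp C = V} from
    ⟨hC', he⟩)
  rwa [hCd, dist_zero_left, dist_zero_left] at this

/-- Compactness is used for a ball of generators in `S`, not for the set of exponentials, which may
fail to be closed. -/
theorem exists_exp_mul_eq_of_forall_approx [FiniteDimensional ℝ 𝔸] (S : Submodule ℝ 𝔸) {p q : 𝔸} {r : ℝ}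
    (h : ∀ ε > 0, ∃ C ∈ S, ‖C‖ ≤ r + ε ∧ ‖exp C * p - q‖ ≤ ε) :
    ∃ C ∈ S, exp C * p = q ∧ ‖C‖ ≤ r := by
  have : ProperSpace 𝔸 := FiniteDimensional.proper ℝ 𝔸
  have hK : IsCompact ((S : Set 𝔸) ∩ Metric.closedBall 0 (r + 1)) :=
    (isCompact_closedBall _ _).inter_left S.closed_of_finiteDimensional
  have hcont : Continuous fun C : 𝔸 => max (‖C‖ - r) ‖exp C * p - q‖ := by
    have := continuous_exp_real_algebra (𝔸 := 𝔸)
    fun_prop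
  obtain ⟨C₁, hC₁, hC₁r, -⟩ := h 1 one_pos
  obtain ⟨C, hC, hmin⟩ := hK.exists_isMinOn ⟨C₁, hC₁, by simpa using hC₁r⟩ hcont.continuousOn
  have hle : max (‖C‖ - r) ‖exp C * p - q‖ ≤ 0 := by
    refine le_of_forall_pos_le_add fun ε hε => ?_
    obtain ⟨C', hC', hr, he⟩ := h (min ε 1) (lt_min hε one_pos)
    refine (hmin ⟨hC', ?_⟩).trans ?_
    · rw [mem_closedBall_zero_iff]
      linarith [min_le_right ε 1]
    · rw [zero_add]
      exact max_le (by linarith [min_le_left ε 1]) (he.trans (min_le_left _ _))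
  refine ⟨C, hC.1, ?_, by linarith [(le_max_left _ _).trans hle]⟩
  exact sub_eq_zero.1 (norm_le_zero_iff.1 ((le_max_right _ _).trans hle))

/-- The evolution generated by `K` is the exponential of an element of `S` no longer than the
increment of a primitive `I` of the speed `‖K‖`. -/
theorem exists_exp_mul_eq_of_hasDerivWithinAt [FiniteDimensional ℝ 𝔸] (hS : IsSkewLieSubspace S τ) {K W : ℝ → 𝔸}
    {I : ℝ → ℝ} {a b : ℝ} (hab : a ≤ b) (hW : ContinuousOn W (Icc a b))
    (hI : ContinuousOn I (Icc a b)) (hK : ∀ t ∈ Ico a b, K t ∈ S)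
    (hW' : ∀ t ∈ Ico a b, HasDerivWithinAt W (K t * W t) (Ici t) t)
    (hI' : ∀ t ∈ Ico a b, HasDerivWithinAt I ‖K t‖ (Ici t) t) :
    ∃ C ∈ S, exp C * W a = W b ∧ ‖C‖ ≤ I b - I a := by
  have : ProperSpace 𝔸 := FiniteDimensional.proper ℝ 𝔸
  have hE := continuous_exp_real_algebra (𝔸 := 𝔸)
  suffices hmain : ∀ ε > 0, ∀ t ∈ Icc a b, ∃ C ∈ S, ‖C‖ ≤ I t - I a + ε * (t - a) ∧
      ‖exp C * W a - W t‖ ≤ ε * (t - a) by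
    refine exists_exp_mul_eq_of_forall_approx S fun ε hε => ?_
    have hpos : 0 < b - a + 1 := by linarith
    obtain ⟨C, hC, h1, h2⟩ := hmain (ε / (b - a + 1)) (div_pos hε hpos) b ⟨hab, le_rfl⟩
    have hle : ε / (b - a + 1) * (b - a) ≤ ε := by
      rw [div_mul_eq_mul_div, div_le_iff₀ hpos]
      nlinarith
    exact ⟨C, hC, by linarith, h2.trans hle⟩
  intro ε hε
  let s : Set ℝ := {t | ∃ C ∈ S, ‖C‖ ≤ I t - I a + ε * (t - a) ∧ ‖exp C * W a - W t‖ ≤ ε * (t - a)}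
  -- The set of good times is the projection of a compact set of pairs `(t, C)`, as `R` bounds all
  -- generators involved.
  have hclosed : IsClosed (s ∩ Icc a b) := by
    obtain ⟨R, hR⟩ := (isCompact_Icc.image_of_continuousOn
      (f := fun t => I t - I a + ε * (t - a)) (by fun_prop)).bddAbove
    let B : Set (ℝ × 𝔸) := Icc a b ×ˢ ((S : Set 𝔸) ∩ Metric.closedBall 0 R)
    have hBc : IsCompact B :=
      isCompact_Icc.prod ((isCompact_closedBall _ _).inter_left S.closed_of_finiteDimensional)
    have hIB : ContinuousOn (fun p : ℝ × 𝔸 => I p.1) B :=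
      hI.comp continuousOn_fst fun p hp => hp.1
    have hWB : ContinuousOn (fun p : ℝ × 𝔸 => W p.1) B :=
      hW.comp continuousOn_fst fun p hp => hp.1
    have h1 : IsClosed {p ∈ B | ‖p.2‖ ≤ I p.1 - I a + ε * (p.1 - a)} :=
      hBc.isClosed.isClosed_le (by fun_prop)
        ((hIB.sub continuousOn_const).add (by fun_prop))
    have h2 : IsClosed {p ∈ B | ‖exp p.2 * W a - W p.1‖ ≤ ε * (p.1 - a)} :=
      hBc.isClosed.isClosed_le
        (((hE.comp continuous_snd).mul continuous_const).continuousOn.sub hWB).norm (by fun_prop)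
    have hc := ((hBc.of_isClosed_subset h1 fun p hp => hp.1).inter_right h2).image continuous_fst
    convert hc.isClosed using 1
    ext t
    constructor
    · rintro ⟨⟨C, hC, hCn, hCe⟩, ht⟩
      have hB : (t, C) ∈ B :=
        ⟨ht, hC, mem_closedBall_zero_iff.2 (hCn.trans (hR (mem_image_of_mem _ ht)))⟩
      exact ⟨(t, C), ⟨⟨hB, hCn⟩, hB, hCe⟩, rfl⟩
    · rintro ⟨⟨t', C⟩, ⟨⟨hB, hCn⟩, -, hCe⟩, rfl⟩
      exact ⟨⟨C, hB.2.1, hCn, hCe⟩, hB.1⟩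
  have ha : a ∈ s := ⟨0, S.zero_mem, by simp, by simp⟩
  refine hclosed.Icc_subset_of_forall_exists_gt ha fun x hx y hy => ?_
  obtain ⟨⟨C, hC, hCn, hCe⟩, hxab⟩ := hx
  -- Freezing the generator at time `x` reproduces `W` to first order. A short step therefore costs
  -- at most `ε * (t - x)` in position, and the speed `‖K x‖` matches the increment of `I` up to the
  -- same error.
  have hd : HasDerivWithinAt (fun t => exp ((t - x) • K x) * W x - W t) 0 (Ici x) x := by
    have h1 : HasDerivAt (fun t : ℝ => exp ((t - x) • K x) * W x) (K x * W x) x := by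
      have h := hasDerivAt_exp_smul_const' (𝕂 := ℝ) (K x) (x - x)
      have := (h.comp_sub_const x x).mul_const (W x)
      simpa using this
    simpa using h1.hasDerivWithinAt.fun_sub (hW' x hxab)
  have e1 := (hasDerivWithinAt_iff_isLittleO.1 hd).def hε
  have e2 := (hasDerivWithinAt_iff_isLittleO.1 (hI' x hxab)).def hε
  have e3 : ∀ᶠ t in 𝓝[>] x, t ∈ Ioc x (min y b) :=
    Ioc_mem_nhdsGT (lt_min hy hxab.2)
  have hmono : 𝓝[>] x ≤ 𝓝[≥] x := nhdsWithin_mono x Ioi_subset_Ici_self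
  obtain ⟨t, h1, h2, h3⟩ := ((e1.filter_mono hmono).and ((e2.filter_mono hmono).and e3)).exists
  have hxt : 0 < t - x := sub_pos.2 h3.1
  simp only [sub_self, zero_smul, exp_zero, one_mul, smul_zero, sub_zero, smul_eq_mul,
    Real.norm_of_nonneg hxt.le] at h1 h2
  have hKS : (t - x) • K x ∈ S := S.smul_mem _ (hK x hxab)
  obtain ⟨C', hC', hCe', hCn'⟩ := hS.exists_exp_eq_mul hKS hC
  refine ⟨t, ⟨C', hC', ?_, ?_⟩, h3.1, h3.2.trans (min_le_left _ _)⟩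
  · rw [norm_smul, Real.norm_of_nonneg hxt.le] at hCn'
    have := (abs_le.1 h2).1
    nlinarith
  · have hsplit : exp C' * W a - W t =
        exp ((t - x) • K x) * (exp C * W a - W x) + (exp ((t - x) • K x) * W x - W t) := by
      rw [hCe', mul_sub, mul_assoc]
      abel
    rw [hsplit]
    refine (norm_add_le _ _).trans ?_
    rw [hS.norm_exp_mul _ hKS]
    nlinarith

/-- Nothing is known about derivatives at the endpoints, so the interval is shrunk slightly, and
continuity of `W` and `I` there turns the result into an approximate one on `[a, b]`. -/
theorem exists_exp_mul_eq_of_Ioo [FiniteDimensional ℝ 𝔸] (hS : IsSkewLieSubspace S τ) {K W : ℝ → 𝔸}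
    {I : ℝ → ℝ} {a b : ℝ} (hab : a ≤ b) (hW : ContinuousOn W (Icc a b))
    (hI : ContinuousOn I (Icc a b)) (hK : ∀ t ∈ Ioo a b, K t ∈ S)
    (hW' : ∀ t ∈ Ioo a b, HasDerivAt W (K t * W t) t)
    (hI' : ∀ t ∈ Ioo a b, HasDerivAt I ‖K t‖ t) :
    ∃ C ∈ S, exp C * W a = W b ∧ ‖C‖ ≤ I b - I a := by
  rcases hab.eq_or_lt with rfl | hlt
  · exact ⟨0, S.zero_mem, by simp, by simp⟩
  refine exists_exp_mul_eq_of_forall_approx S fun ε hε => ?_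
  obtain ⟨nWa, nWb⟩ := hW.eventually_dist_endpoints_lt hlt (half_pos hε)
  obtain ⟨nIa, nIb⟩ := hI.eventually_dist_endpoints_lt hlt (half_pos hε)
  have hmid : a < (a + b) / 2 ∧ (a + b) / 2 < b := ⟨by linarith, by linarith⟩
  obtain ⟨a', ⟨hWa, hIa⟩, ha'⟩ := ((nWa.and nIa).and
    (Ioo_mem_nhdsGT hmid.1)).exists
  obtain ⟨b', ⟨hWb, hIb⟩, hb'⟩ := ((nWb.and nIb).and
    (Ioo_mem_nhdsLT hmid.2)).exists
  have hsub : Icc a' b' ⊆ Icc a b := Icc_subset_Icc ha'.1.le hb'.2.le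
  have hsub' : ∀ t ∈ Ico a' b', t ∈ Ioo a b := fun t ht =>
    ⟨ha'.1.trans_le ht.1, ht.2.trans hb'.2⟩
  obtain ⟨C, hC, hCe, hCn⟩ := hS.exists_exp_mul_eq_of_hasDerivWithinAt
    (ha'.2.trans hb'.1).le (hW.mono hsub) (hI.mono hsub) (fun t ht => hK t (hsub' t ht))
    (fun t ht => (hW' t (hsub' t ht)).hasDerivWithinAt)
    (fun t ht => (hI' t (hsub' t ht)).hasDerivWithinAt)
  refine ⟨C, hC, ?_, ?_⟩
  · rw [Real.dist_eq] at hIa hIb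
    linarith [(abs_lt.1 hIa).1, (abs_lt.1 hIb).2]
  · have hsplit : exp C * W a - W b = -(exp C * (W a' - W a)) + (W b' - W b) := by
      rw [mul_sub, hCe]
      abel
    rw [hsplit]
    refine (norm_add_le _ _).trans ?_
    rw [norm_neg, hS.norm_exp_mul _ hC, ← dist_eq_norm, ← dist_eq_norm]
    linarith

/-- Splitting at an exceptional time inside the interval gives two generators, which
`exists_exp_eq_mul` merges without loss of length. The interval is quantified inside the induction
so that both halves are covered. -/
theorem exists_exp_mul_eq_off_finite [FiniteDimensional ℝ 𝔸] (hS : IsSkewLieSubspace S τ) {K W : ℝ → 𝔸}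
    {I : ℝ → ℝ} {D : Set ℝ} (hD : D.Finite) : ∀ {a b : ℝ}, a ≤ b → ContinuousOn W (Icc a b) →
    ContinuousOn I (Icc a b) → (∀ t ∈ Ioo a b \ D, K t ∈ S) →
    (∀ t ∈ Ioo a b \ D, HasDerivAt W (K t * W t) t) →
    (∀ t ∈ Ioo a b \ D, HasDerivAt I ‖K t‖ t) →
    ∃ C ∈ S, exp C * W a = W b ∧ ‖C‖ ≤ I b - I a := by
  induction D, hD using Set.Finite.induction_on with
  | empty =>
    intro a b hab hW hI hK hW' hI'
    simp only [sdiff_empty] at hK hW' hI'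
    exact hS.exists_exp_mul_eq_of_Ioo hab hW hI hK hW' hI'
  | @insert d D _ _ ih =>
    intro a b hab hW hI hK hW' hI'
    by_cases hd : d ∈ Ioo a b
    · have h1 : ∀ t ∈ Ioo a d \ D, t ∈ Ioo a b \ insert d D := fun t ht =>
        ⟨⟨ht.1.1, ht.1.2.trans hd.2⟩, fun h => h.elim (fun e => ht.1.2.ne e) ht.2⟩
      have h2 : ∀ t ∈ Ioo d b \ D, t ∈ Ioo a b \ insert d D := fun t ht =>
        ⟨⟨hd.1.trans ht.1.1, ht.1.2⟩, fun h => h.elim (fun e => ht.1.1.ne' e) ht.2⟩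
      have s1 : Icc a d ⊆ Icc a b := Icc_subset_Icc_right hd.2.le
      have s2 : Icc d b ⊆ Icc a b := Icc_subset_Icc_left hd.1.le
      obtain ⟨C₁, hC₁, he₁, hn₁⟩ := ih hd.1.le (hW.mono s1) (hI.mono s1)
        (fun t ht => hK t (h1 t ht)) (fun t ht => hW' t (h1 t ht)) (fun t ht => hI' t (h1 t ht))
      obtain ⟨C₂, hC₂, he₂, hn₂⟩ := ih hd.2.le (hW.mono s2) (hI.mono s2)
        (fun t ht => hK t (h2 t ht)) (fun t ht => hW' t (h2 t ht)) (fun t ht => hI' t (h2 t ht))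
      obtain ⟨C, hC, he, hn⟩ := hS.exists_exp_eq_mul hC₂ hC₁
      exact ⟨C, hC, by rw [he, mul_assoc, he₁, he₂], by linarith⟩
    · have h1 : ∀ t ∈ Ioo a b \ D, t ∈ Ioo a b \ insert d D := fun t ht =>
        ⟨ht.1, fun h => h.elim (fun e => hd (e ▸ ht.1)) ht.2⟩
      exact ih hab hW hI (fun t ht => hK t (h1 t ht)) (fun t ht => hW' t (h1 t ht))
        (fun t ht => hI' t (h1 t ht))

theorem exists_exp_mul_eq_of_intervalIntegrable [FiniteDimensional ℝ 𝔸] (hS : IsSkewLieSubspace S τ) {K W : ℝ → 𝔸}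
    {D : Set ℝ} (hD : D.Finite) {T : ℝ} (hT : 0 ≤ T) (hW : ContinuousOn W (Icc 0 T))
    (hint : IntervalIntegrable (fun t => ‖K t‖) volume 0 T)
    (hK : ∀ t ∈ Ioo 0 T \ D, K t ∈ S) (hKc : ∀ t ∈ Ioo 0 T \ D, ContinuousAt K t)
    (hW' : ∀ t ∈ Ioo 0 T \ D, HasDerivAt W (K t * W t) t) :
    ∃ C ∈ S, exp C * W 0 = W T ∧ ‖C‖ ≤ ∫ t in (0 : ℝ)..T, ‖K t‖ := by
  have hion : IntegrableOn (fun t => ‖K t‖) (uIcc 0 T) := by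
    rw [uIcc_of_le hT, integrableOn_Icc_iff_integrableOn_Ioc]
    exact (intervalIntegrable_iff_integrableOn_Ioc_of_le hT).1 hint
  have hI : ContinuousOn (fun x => ∫ t in (0 : ℝ)..x, ‖K t‖) (Icc 0 T) := by
    have := intervalIntegral.continuousOn_primitive_interval hion
    rwa [uIcc_of_le hT] at this
  obtain ⟨C, hC, he, hn⟩ := hS.exists_exp_mul_eq_off_finite (K := K) hD hT hW hI hK hW'
    fun t ht => by
      refine intervalIntegral.integral_hasDerivAt_right
        (hint.mono_set ?_) ?_ (hKc t ht).norm
      · rw [uIcc_of_le hT, uIcc_of_le ht.1.1.le]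
        exact Icc_subset_Icc_right ht.1.2.le
      · exact ⟨uIcc 0 T, by rw [uIcc_of_le hT]; exact Icc_mem_nhds ht.1.1 ht.1.2,
          hion.aestronglyMeasurable⟩
  exact ⟨C, hC, he, by simpa using hn⟩

end IsSkewLieSubspace

theorem intervalIntegrable_of_continuousAt_off_finite {E : Type*} [NormedAddCommGroup E]
    [SecondCountableTopology E] {f : ℝ → E} {D : Set ℝ} (hD : D.Finite) {T M : ℝ}
    (hT : 0 ≤ T) (hf : ∀ t ∈ Icc 0 T \ D, ContinuousAt f t) (hM : ∀ t ∈ Icc 0 T, ‖f t‖ ≤ M) :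
    IntervalIntegrable f volume 0 T := by
  rw [intervalIntegrable_iff_integrableOn_Icc_of_le hT]
  have hm : AEStronglyMeasurable f (volume.restrict (Icc 0 T \ D)) :=
    ContinuousOn.aestronglyMeasurable (fun t ht => (hf t ht).continuousWithinAt)
      (measurableSet_Icc.diff hD.measurableSet)
  have hnull : volume D = 0 := hD.measure_zero volume
  rw [Measure.restrict_congr_set (sdiff_null_ae_eq_self hnull)] at hm
  exact IntegrableOn.of_bound (by simp) hm M
    ((ae_restrict_iff' measurableSet_Icc).2 (ae_of_all _ hM))

end Evolution

/-! ### Anti-Hermitian matrices with the Frobenius norm. -/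

section SkewHermitian

open NormedSpace

variable {n : Type*} [Fintype n] [DecidableEq n]

theorem Matrix.frobenius_norm_sq_eq_re_trace (A : Matrix n n ℂ) :
    ‖A‖ ^ 2 = (Aᴴ * A).trace.re := by
  have h : ‖A‖ ^ 2 = ∑ i, ∑ j, ‖A i j‖ ^ 2 := by
    rw [Matrix.frobenius_norm_def, ← Real.sqrt_eq_rpow, Real.sq_sqrt (by positivity)]
    simp
  rw [h, Finset.sum_comm]
  simp [Matrix.trace, Matrix.mul_apply, ← Complex.normSq_eq_conj_mul_self, Complex.sq_norm]

theorem Matrix.frobenius_norm_mul_left {U : Matrix n n ℂ} (hU : Uᴴ * U = 1) (A : Matrix n n ℂ) :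
    ‖U * A‖ = ‖A‖ := by
  have h : ‖U * A‖ ^ 2 = ‖A‖ ^ 2 := by
    rw [Matrix.frobenius_norm_sq_eq_re_trace, Matrix.frobenius_norm_sq_eq_re_trace,
      Matrix.conjTranspose_mul, Matrix.mul_assoc, ← Matrix.mul_assoc Uᴴ, hU, Matrix.one_mul]
  exact (pow_left_inj₀ (norm_nonneg _) (norm_nonneg _) two_ne_zero).1 h

theorem Matrix.frobenius_norm_mul_right {U : Matrix n n ℂ} (hU : U * Uᴴ = 1) (A : Matrix n n ℂ) :
    ‖A * U‖ = ‖A‖ := by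
  rw [← Matrix.frobenius_norm_conjTranspose, Matrix.conjTranspose_mul,
    Matrix.frobenius_norm_mul_left (by rwa [Matrix.conjTranspose_conjTranspose]),
    Matrix.frobenius_norm_conjTranspose]

theorem Matrix.conjTranspose_exp_of_skew {X : Matrix n n ℂ} (hX : Xᴴ = -X) :
    (exp X)ᴴ = exp (-X) := by
  rw [← Matrix.exp_conjTranspose, hX]

theorem Matrix.conjTranspose_exp_mul_exp_of_skew {X : Matrix n n ℂ} (hX : Xᴴ = -X) :
    (exp X)ᴴ * exp X = 1 :=
  (congrArg (· * exp X) (Matrix.conjTranspose_exp_of_skew hX)).trans (exp_neg_mul_exp X)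

/-- The real part of the trace, as a continuous real-linear functional. -/
noncomputable def reTraceCLM (n : Type*) [Fintype n] [DecidableEq n] : Matrix n n ℂ →L[ℝ] ℝ :=
  LinearMap.toContinuousLinearMap (Complex.reLm ∘ₗ Matrix.traceLinearMap n ℝ ℂ)

variable {L : LieSubalgebra ℝ (Matrix n n ℂ)}

theorem LieSubalgebra.isSkewLieSubspace (hL : ∀ X ∈ L, Xᴴ = -X) :
    IsSkewLieSubspace L.toSubmodule (reTraceCLM n) where
  commutator_mem X hX Y hY := L.lie_mem hX hY
  trace_mul_comm a b := congrArg Complex.re (Matrix.trace_mul_comm a b)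
  norm_sq X hX := by
    have h : ‖X‖ ^ 2 = -(X * X).trace.re := by
      rw [Matrix.frobenius_norm_sq_eq_re_trace, hL X hX]
      simp
    exact h
  norm_exp_mul X hX a := Matrix.frobenius_norm_mul_left
    (Matrix.conjTranspose_exp_mul_exp_of_skew (hL X hX)) a

theorem neg_I_smul_mem {H : Matrix n n ℂ} (hH : Complex.I • H ∈ L) : -(Complex.I • H) ∈ L :=
  L.toSubmodule.neg_mem hH

/-- Only the existence of a generator is kept, not its length: it yields unitarity of the propagator
and invariance of `L` under conjugation by it. -/
theorem IsPropagator.exists_exp_eq (hL : ∀ X ∈ L, Xᴴ = -X) {H U : ℝ → Matrix n n ℂ}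
    (hmem : ∀ t : ℝ, 0 ≤ t → Complex.I • H t ∈ L) (hpc : IsPiecewiseContinuous H)
    (hbdd : IsBoundedOnIntervals H) (hU : IsPropagator H U) {T : ℝ} (hT : 0 ≤ T) :
    U T ∈ expImage L := by
  obtain ⟨M, hM⟩ := hbdd T
  have hcont : ∀ t ∈ Icc 0 T \ {t ∈ Icc 0 T | ¬ ContinuousAt H t}, ContinuousAt H t :=
    fun t ht => by
      by_contra h
      exact ht.2 ⟨ht.1, h⟩
  have hint := intervalIntegrable_of_continuousAt_off_finite (hpc T) hT hcont hM
  obtain ⟨C, hC, he, -⟩ :=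
    (LieSubalgebra.isSkewLieSubspace hL).exists_exp_mul_eq_of_intervalIntegrable
      (K := fun t => -(Complex.I • H t)) (W := U) (hpc T) hT
      (hU.continuousOn.mono Icc_subset_Ici_self) (by simpa [norm_smul] using hint.norm)
      (fun t ht => neg_I_smul_mem (hmem t ht.1.1.le))
      (fun t ht => ((hcont t ⟨Ioo_subset_Icc_self ht.1, ht.2⟩).const_smul Complex.I).neg)
      (fun t ht => (hU.schroedinger t ht.1.1
        (hcont t ⟨Ioo_subset_Icc_self ht.1, ht.2⟩)).congr_deriv (by simp))
  exact ⟨C, hC, by rwa [hU.initial, mul_one] at he⟩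

end SkewHermitian

/-! ### Comparison of two propagators in the interaction picture. -/

theorem mainTheorem6 {n : Type*} [Fintype n] [DecidableEq n]
    (L : LieSubalgebra ℝ (Matrix n n ℂ)) (hL : ∀ X ∈ L, Xᴴ = -X)
    (H_A H_B U_A U_B : ℝ → Matrix n n ℂ)
    (hA_herm : ∀ t : ℝ, 0 ≤ t → (H_A t).IsHermitian)
    (hB_herm : ∀ t : ℝ, 0 ≤ t → (H_B t).IsHermitian)
    (hA_mem : ∀ t : ℝ, 0 ≤ t → Complex.I • H_A t ∈ L)
    (hB_mem : ∀ t : ℝ, 0 ≤ t → Complex.I • H_B t ∈ L)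
    (hA_pc : IsPiecewiseContinuous H_A) (hB_pc : IsPiecewiseContinuous H_B)
    (hA_bdd : IsBoundedOnIntervals H_A) (hB_bdd : IsBoundedOnIntervals H_B)
    (hU_A : IsPropagator H_A U_A) (hU_B : IsPropagator H_B U_B) :
    ∀ T : ℝ, 0 ≤ T →
      (U_A T ∈ expImage L ∧ U_B T ∈ expImage L) ∧
      IsLeast (generatorNorms L (U_A T) (U_B T)) (unitaryDist L (U_A T) (U_B T)) ∧
      IntervalIntegrable (fun t => ‖H_A t - H_B t‖) volume 0 T ∧
      unitaryDist L (U_A T) (U_B T) ≤ ∫ t in (0 : ℝ)..T, ‖H_A t - H_B t‖ ∧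
      ‖U_A T - U_B T‖ ≤ unitaryDist L (U_A T) (U_B T) := by
  intro T hT
  have hS := LieSubalgebra.isSkewLieSubspace hL
  have hA := fun t (ht : 0 ≤ t) => hU_A.exists_exp_eq hL hA_mem hA_pc hA_bdd ht
  have hB := fun t (ht : 0 ≤ t) => hU_B.exists_exp_eq hL hB_mem hB_pc hB_bdd ht
  have hBl : ∀ t, 0 ≤ t → (U_B t)ᴴ * U_B t = 1 := fun t ht => by
    obtain ⟨C, hC, he⟩ := hB t ht
    rw [← he, Matrix.conjTranspose_exp_mul_exp_of_skew (hL C hC)]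
  have hBr : ∀ t, 0 ≤ t → U_B t * (U_B t)ᴴ = 1 := fun t ht => mul_eq_one_comm.1 (hBl t ht)
  let D : Set ℝ := {t ∈ Icc 0 T | ¬ ContinuousAt H_A t} ∪ {t ∈ Icc 0 T | ¬ ContinuousAt H_B t}
  have hD : D.Finite := (hA_pc T).union (hB_pc T)
  have hcA : ∀ t ∈ Icc 0 T \ D, ContinuousAt H_A t := fun t ht => by
    by_contra h
    exact ht.2 (Or.inl ⟨ht.1, h⟩)
  have hcB : ∀ t ∈ Icc 0 T \ D, ContinuousAt H_B t := fun t ht => by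
    by_contra h
    exact ht.2 (Or.inr ⟨ht.1, h⟩)
  obtain ⟨MA, hMA⟩ := hA_bdd T
  obtain ⟨MB, hMB⟩ := hB_bdd T
  have hint : IntervalIntegrable (fun t => ‖H_A t - H_B t‖) volume 0 T :=
    (intervalIntegrable_of_continuousAt_off_finite hD hT
      (fun t ht => (hcA t ht).sub (hcB t ht)) fun t ht =>
        (norm_sub_le _ _).trans (add_le_add (hMA t ht) (hMB t ht))).norm
  -- Generator of `U_Bᴴ U_A`: the evolution under `H_B` cancels and only the difference of the
  -- Hamiltonians remains, rotated by `U_B`.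
  let K : ℝ → Matrix n n ℂ := fun t => (U_B t)ᴴ * (-(Complex.I • (H_A t - H_B t))) * U_B t
  have hKnorm : ∀ t, 0 ≤ t → ‖K t‖ = ‖H_A t - H_B t‖ := fun t ht => by
    rw [Matrix.frobenius_norm_mul_right (hBr t ht), Matrix.frobenius_norm_mul_left, norm_neg,
      norm_smul, Complex.norm_I, one_mul]
    rw [Matrix.conjTranspose_conjTranspose, hBr t ht]
  have hKmem : ∀ t, 0 ≤ t → K t ∈ L := fun t ht => by
    obtain ⟨C, hC, he⟩ := hB t ht
    have hmem : -(Complex.I • (H_A t - H_B t)) ∈ L := neg_I_smul_mem <| by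
      rw [smul_sub]
      exact L.toSubmodule.sub_mem (hA_mem t ht) (hB_mem t ht)
    have h : NormedSpace.exp (-C) * (-(Complex.I • (H_A t - H_B t))) * NormedSpace.exp (- -C) ∈ L :=
      hS.exp_conj_mem (L.toSubmodule.neg_mem hC) hmem
    rwa [neg_neg, ← Matrix.conjTranspose_exp_of_skew (hL C hC), he] at h
  have hdA : ∀ t ∈ Ioo 0 T \ D, HasDerivAt U_A (-(Complex.I • (H_A t * U_A t))) t := fun t ht =>
    hU_A.schroedinger t ht.1.1 (hcA t ⟨Ioo_subset_Icc_self ht.1, ht.2⟩)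
  have hdB : ∀ t ∈ Ioo 0 T \ D, HasDerivAt U_B (-(Complex.I • (H_B t * U_B t))) t := fun t ht =>
    hU_B.schroedinger t ht.1.1 (hcB t ⟨Ioo_subset_Icc_self ht.1, ht.2⟩)
  have hW' : ∀ t ∈ Ioo 0 T \ D,
      HasDerivAt (fun s => (U_B s)ᴴ * U_A s) (K t * ((U_B t)ᴴ * U_A t)) t := fun t ht => by
    refine ((hdB t ht).star.fun_mul (hdA t ht)).congr_deriv ?_
    have h1 : (-(Complex.I • (H_B t * U_B t)))ᴴ = (U_B t)ᴴ * (Complex.I • H_B t) := by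
      simp [(hB_herm t ht.1.1.le).eq]
    have h2 : K t * ((U_B t)ᴴ * U_A t) =
        (U_B t)ᴴ * (-(Complex.I • (H_A t - H_B t))) * (U_B t * (U_B t)ᴴ) * U_A t := by
      simp only [K, Matrix.mul_assoc]
    rw [Matrix.star_eq_conjTranspose, Matrix.star_eq_conjTranspose, h1, h2, hBr t ht.1.1.le, Matrix.mul_one]
    simp only [smul_sub, neg_sub, Matrix.mul_sub, Matrix.sub_mul, Matrix.mul_neg,
      Matrix.mul_smul, Matrix.smul_mul, Matrix.mul_assoc]
    abel
  obtain ⟨C, hC, hCe, hCn⟩ := hS.exists_exp_mul_eq_of_intervalIntegrable (K := K) hD hT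
    (W := fun s => (U_B s)ᴴ * U_A s)
    (((hU_B.continuousOn.mono Icc_subset_Ici_self).star).mul
      (hU_A.continuousOn.mono Icc_subset_Ici_self))
    (hint.congr fun t ht => by
      rw [uIoc_of_le hT] at ht
      exact (hKnorm t ht.1.le).symm)
    (fun t ht => hKmem t ht.1.1.le)
    (fun t ht => by
      have htc : t ∈ Icc 0 T \ D := ⟨Ioo_subset_Icc_self ht.1, ht.2⟩
      have hUc := (hdB t ht).continuousAt
      exact (hUc.star.mul (((hcA t htc).sub (hcB t htc)).const_smul Complex.I).neg).mul hUc)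
    hW'
  have hintK : ∫ t in (0 : ℝ)..T, ‖K t‖ = ∫ t in (0 : ℝ)..T, ‖H_A t - H_B t‖ :=
    intervalIntegral.integral_congr fun t ht => hKnorm t (by rw [uIcc_of_le hT] at ht; exact ht.1)
  have hinv : (U_B T)⁻¹ = (U_B T)ᴴ := Matrix.inv_eq_right_inv (hBr T hT)
  replace hCe : NormedSpace.exp C = (U_B T)ᴴ * U_A T := by
    have h : NormedSpace.exp C * ((U_B 0)ᴴ * U_A 0) = (U_B T)ᴴ * U_A T := hCe
    simpa only [hU_A.initial, hU_B.initial, Matrix.conjTranspose_one, mul_one] using h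
  -- `C` generates `U_Bᴴ U_A`, while the metric asks for `U_A U_B⁻¹`; the two are conjugate by
  -- `U_B`, which preserves both `L` and the norm.
  have hC' : U_B T * C * (U_B T)⁻¹ ∈ L := by
    obtain ⟨X, hX, he⟩ := hB T hT
    rw [hinv, ← he, Matrix.conjTranspose_exp_of_skew (hL X hX)]
    exact hS.exp_conj_mem hX hC
  have hCe' : NormedSpace.exp (U_B T * C * (U_B T)⁻¹) = U_A T * (U_B T)⁻¹ := by
    rw [Matrix.exp_conj _ _ (IsUnit.of_mul_eq_one _ (hBr T hT)), hCe, ← Matrix.mul_assoc, hBr T hT,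
      Matrix.one_mul]
  have hCn' : ‖U_B T * C * (U_B T)⁻¹‖ = ‖C‖ := by
    rw [hinv, Matrix.frobenius_norm_mul_right, Matrix.frobenius_norm_mul_left (hBl T hT)]
    rw [Matrix.conjTranspose_conjTranspose, hBl T hT]
  obtain ⟨C₀, hC₀, he₀, hmin⟩ := IsSkewLieSubspace.exists_exp_eq_of_minimal_norm L.toSubmodule
    ⟨_, hC', hCe'⟩
  replace he₀ : NormedSpace.exp C₀ = U_A T * (U_B T)⁻¹ := he₀
  have hleast : IsLeast (generatorNorms L (U_A T) (U_B T)) ‖C₀‖ :=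
    ⟨⟨C₀, hC₀, he₀, rfl⟩, fun r ⟨X, hX, hXe, hXr⟩ => hXr ▸ hmin X hX hXe⟩
  have hdist : unitaryDist L (U_A T) (U_B T) = ‖C₀‖ := hleast.csInf_eq
  rw [hdist]
  refine ⟨⟨hA T hT, hB T hT⟩, hleast, hint, ?_, ?_⟩
  · rw [← hintK]
    exact (hmin _ hC' hCe').trans (hCn'.trans_le hCn)
  · have hdiff : U_A T - U_B T = (NormedSpace.exp C₀ - 1) * U_B T := by
      rw [he₀, Matrix.sub_mul, hinv, Matrix.mul_assoc, hBl T hT, Matrix.mul_one, Matrix.one_mul]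
    rw [hdiff, Matrix.frobenius_norm_mul_right (hBr T hT)]
    exact hS.norm_exp_sub_one_le hC₀
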